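/- **Conventions.** A *value map* on a commutative ring $T$ is a map $v:T\to\mathbb R\cup\{\infty\}$ with $v(ab)=v(a)+v(b)$, $v(a+b)\ge\min\{v(a),v(b)\}$ and $v(0)=\infty$ (other elements may also have value $\infty$). It is *normalized* if $v(c)\ge 0$ for all $c\in T$ and $v(c)>0$ for all non-units $c$. A $T$-module $M$ is *almost zero* (with respect to $v$) if for all $m\in M$ and $\epsilon>0$ there is $b\in T$ with $bm=0$ and $v(b)<\epsilon$. Let $(R,\mathfrak m)$ be a Noetherian local ring of dimension $d$ and $T$ an $R$-algebra with a value map. A $T$-module $M$ is *almost Cohen–Macaulay over $R$* if the $T$-modules $H^i_{\mathfrak m}(M)$ (the cohomology of the Čech complex of $M$ with respect to a finite sequence generating $\mathfrak m$) are almost zero for all $i\neq d$, but $M/\mathfrak mM$ is not almost zero. For a reduced ring $A$ of prime characteristic $p$, $A_\infty=\bigcup_n A^{p^{-n}}$ denotes its perfect closure. **Corollary.** Let $p$ be a prime, let $R$ be a regular local ring of characteristic $p$, and let $S$ be a reduced local ring that is a module-finite extension of $R$ (so $R\to S$ is injective). Then: 1. $S_\infty$ is an almost Cohen–Macaulay $R$-algebra;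 that is, for every normalized value map $v$ on $S_\infty$ with $v(c)\neq\infty$ for all $0\ne c\in R$, the $S_\infty$-module $S_\infty$ is almost Cohen–Macaulay over $R$ with respect to $v$. 2. The same holds over $R_\infty$: for every normalized value map $v$ on $R_\infty$ with $v(c)\neq\infty$ for all $0\neq c\in R$, the $R_\infty$-module $S_\infty$ is almost Cohen–Macaulay over $R$ with respect to $v$. -/

import Mathlib

/-!  Value maps, almost zero modules, Cech cohomology, almost Cohen-Macaulay modules. -/

namespace AlmostCM

/-- A value map on a ring `T`: a map `v : T → ℝ ∪ {∞}` with `v (a * b) = v a + v b`,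
`v (a + b) ≥ min (v a) (v b)` and `v 0 = ∞`. -/
structure ValueMap (T : Type*) [CommRing T] where
  toFun : T → WithTop ℝ
  map_mul' : ∀ a b : T, toFun (a * b) = toFun a + toFun b
  map_add' : ∀ a b : T, min (toFun a) (toFun b) ≤ toFun (a + b)
  map_zero' : toFun 0 = ⊤

instance (T : Type*) [CommRing T] : CoeFun (ValueMap T) (fun _ => T → WithTop ℝ) where
  coe v := v.toFun

/-- A value map is normalized if it is nonnegative, and positive on the non-units. -/
def ValueMap.IsNormalized {T : Type*} [CommRing T] (v : ValueMap T) : Prop :=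
  (∀ c : T, 0 ≤ v c) ∧ ∀ c : T, ¬ IsUnit c → 0 < v c

/-- A `T`-module `M` is almost zero with respect to `v` if each of its elements is annihilated by
elements of `T` of arbitrarily small value. -/
def AlmostZero {T : Type*} [CommRing T] (v : ValueMap T)
    (M : Type*) [AddCommGroup M] [Module T M] : Prop :=
  ∀ (m : M) (ε : ℝ), 0 < ε → ∃ b : T, b • m = 0 ∧ v b < (ε : WithTop ℝ)

section Cech

variable {T : Type*} [CommRing T] {n : ℕ} (x : Fin n → T) (M : Type*) [AddCommGroup M] [Module T M]

/-- The localization of `M` at the powers of the product of the `x j`, `j ∈ s`. -/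
abbrev CechLoc (s : Finset (Fin n)) : Type _ :=
  LocalizedModule (Submonoid.powers (∏ j ∈ s, x j)) M

variable {M} in
theorem isUnit_end_cechLoc {s t : Finset (Fin n)} (h : s ⊆ t)
    (a : Submonoid.powers (∏ j ∈ s, x j)) :
    IsUnit ((algebraMap T (Module.End T (CechLoc x M t))) a) := by
  obtain ⟨_, k, rfl⟩ := a
  simp only [map_pow]
  refine IsUnit.pow k ?_
  have hu : IsUnit ((algebraMap T (Module.End T (CechLoc x M t))) (∏ j ∈ t, x j)) :=
    IsLocalizedModule.map_units (S := Submonoid.powers (∏ j ∈ t, x j))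
      (LocalizedModule.mkLinearMap (Submonoid.powers (∏ j ∈ t, x j)) M)
      ⟨∏ j ∈ t, x j, Submonoid.mem_powers _⟩
  have he : (∏ j ∈ t, x j) = (∏ j ∈ t \ s, x j) * ∏ j ∈ s, x j := (Finset.prod_sdiff h).symm
  replace hu := (congrArg
    (fun z => IsUnit ((algebraMap T (Module.End T (CechLoc x M t))) z)) he).mp hu
  rw [map_mul] at hu
  exact ((Commute.isUnit_mul_iff (Algebra.commute_algebraMap_left _ _)).mp hu).2

/-- The canonical map between the localizations of `M` attached to `s ⊆ t`. -/
noncomputable def cechRes {s t : Finset (Fin n)} (h : s ⊆ t) :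
    CechLoc x M s →ₗ[T] CechLoc x M t :=
  LocalizedModule.lift (Submonoid.powers (∏ j ∈ s, x j))
    (LocalizedModule.mkLinearMap (Submonoid.powers (∏ j ∈ t, x j)) M)
    (isUnit_end_cechLoc x h)

/-- The Cech cochains of degree `i`: the product (equivalently, the direct sum) of the
localizations of `M` at `x j₁ * ⋯ * x jᵢ`, where `j₁ < ⋯ < jᵢ`. -/
abbrev CechCochain (i : ℕ) : Type _ :=
  ∀ s : {s : Finset (Fin n) // s.card = i}, CechLoc x M s.1

/-- The Cech differential: the component at `s` is the alternating sum, over `j ∈ s`, of the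
images of the components at `s \ {j}`; the sign of the term of `j` is given by the position
of `j` in `s`. -/
noncomputable def cechD (i : ℕ) : CechCochain x M i →ₗ[T] CechCochain x M (i + 1) :=
  LinearMap.pi fun s => ∑ j : {j : Fin n // j ∈ s.1},
    ((-1 : ℤ) ^ (s.1.filter (· < j.1)).card) •
      (cechRes x M (Finset.erase_subset j.1 s.1)).comp
        (LinearMap.proj (⟨s.1.erase j.1, by
          rw [Finset.card_erase_of_mem j.2, s.2, Nat.add_sub_cancel]⟩ :
            {s : Finset (Fin n) // s.card = i}))

/-- The Cech coboundaries of degree `i`. -/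
noncomputable def cechB : (i : ℕ) → Submodule T (CechCochain x M i)
  | 0 => ⊥
  | i + 1 => LinearMap.range (cechD x M i)

/-- The `i`-th cohomology module of the Cech complex of the `T`-module `M` with respect to the
sequence `x`, as a `T`-module: cocycles modulo coboundaries. -/
abbrev CechCohomology (i : ℕ) : Type _ :=
  LinearMap.ker (cechD x M i) ⧸ (cechB x M i).submoduleOf (LinearMap.ker (cechD x M i))

end Cech

/-- Let `(R, 𝔪)` be a Noetherian local ring of dimension `d` and `T` an `R`-algebra with a value
map `v`. The `T`-module `M` is almost Cohen-Macaulay over `R` if the local cohomology modules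
`H^i_𝔪(M)` are almost zero for `i ≠ d`, but `M / 𝔪 M` is not. Here `H^i_𝔪(M)` is the cohomology
of the Cech complex of `M` with respect to a finite sequence that generates `𝔪`; up to
isomorphism it does not depend on that sequence, so all of them are allowed. -/
def IsAlmostCohenMacaulay (R : Type*) [CommRing R] [IsLocalRing R] [IsNoetherianRing R]
    {T : Type*} [CommRing T] [Algebra R T] (v : ValueMap T)
    (M : Type*) [AddCommGroup M] [Module T M] : Prop :=
  (∀ (n : ℕ) (x : Fin n → R), Ideal.span (Set.range x) = IsLocalRing.maximalIdeal R →
    ∀ i : ℕ, (i : WithBot ℕ∞) ≠ ringKrullDim R →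
      AlmostZero v (CechCohomology (fun j => algebraMap R T (x j)) M i)) ∧
  ¬ AlmostZero v
    (M ⧸ ((IsLocalRing.maximalIdeal R).map (algebraMap R T) • (⊤ : Submodule T M)))

section Perfection

variable (p : ℕ) [Fact p.Prime]

/-- The perfect closure of an `R`-algebra `S` of characteristic `p`, as an `R`-algebra through
`R → S → S_∞`. If `S` is reduced, `PerfectClosure S p` is the increasing union of the rings
`S^{p^{-n}}`. -/
noncomputable instance perfectClosureAlgebra (R S : Type*) [CommRing R] [CommRing S] [CharP S p]
    [Algebra R S] : Algebra R (PerfectClosure S p) :=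
  ((PerfectClosure.of S p).comp (algebraMap R S)).toAlgebra

/-- The ring homomorphism `R_∞ → S_∞` induced by `R → S`. -/
noncomputable def perfectClosureMap (R S : Type*) [CommRing R] [CommRing S] [CharP R p] [CharP S p]
    [Algebra R S] : PerfectClosure R p →+* PerfectClosure S p :=
  PerfectClosure.lift R p (PerfectClosure S p) ((PerfectClosure.of S p).comp (algebraMap R S))

/-- `S_∞` as an `R_∞`-module, through the ring homomorphism `R_∞ → S_∞`. -/
noncomputable abbrev perfectClosureModule (R S : Type*) [CommRing R] [CommRing S] [CharP R p]
    [CharP S p] [Algebra R S] : Module (PerfectClosure R p) (PerfectClosure S p) :=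
  Module.compHom (PerfectClosure S p) (perfectClosureMap p R S)

end Perfection

end AlmostCM

/-!
Local cohomology is the direct limit of the cohomologies of the Koszul complexes of the sequences
`x₁ ^ a, …, xₙ ^ a`; for a Cohen-Macaulay ring `R` and a free module it vanishes off `dim R`,
because the radical of `(x)` contains a regular sequence of that length.

Let `A = S_∞`, let `S'` be the image of `S` in `A`, and let `F` be the Frobenius of `A`. As `R` is
a domain, some nonzero `c ∈ R` is such that multiplication by `c` on the finite module `S'` factors
through a free `R`-module; so `c` kills the local cohomology of `S'` off `dim R`. A class `z` in the
local cohomology of `A` has `F^N z` coming from `S'` for large `N`; hence `c • F^N z = 0`, and `F`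
being bijective, `c^{1/p^N} • z = 0`, where `v (c^{1/p^N}) = v c / p^N → 0`.

For the nonvanishing, a normalized `v` is bounded below by a positive constant on the finitely
generated proper ideal `𝔪T`. When `T = S_∞` this bounds `v` on the annihilator of `1 ∈ A / 𝔪A`.
When `T = R_∞` and `b • 1 ∈ 𝔪A`, apply an `R`-linear `h : S' → R` with `h 1 ≠ 0` to a `p^N`-th power
of this relation and take `p^N`-th roots: `(h 1)^{1/p^N} b ∈ 𝔪T`.
-/

namespace AlmostCM

open scoped Pointwise

section Shift

theorem map_pow_smul_of_map_smul {T U M N : Type*} [Monoid T] [Monoid U] [MulAction T M]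
    [MulAction U N] {h : M → N} {r : T} {u : U} (hru : ∀ m, h (r • m) = u • h m) (a : ℕ) (m : M) :
    h (r ^ a • m) = u ^ a • h m := by
  induction a generalizing m with
  | zero => simp only [pow_zero, one_smul]
  | succ a ih => simp only [pow_succ, mul_smul, ih, hru]

variable {ι T M : Type*} [CommRing T] [AddCommGroup M] [Module T M]

/-- Multiplication of the component at `s` by `(∏ j ∈ s, x j) ^ e`. These are the transition maps,
for varying `a`, between the Koszul complexes of the sequences `x ^ a`. -/
def koszulShift (x : ι → T) (e : ℕ) : (Finset ι → M) →ₗ[T] (Finset ι → M) :=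
  LinearMap.pi fun s => (∏ j ∈ s, x j) ^ e • LinearMap.proj s

theorem koszulShift_apply (x : ι → T) (e : ℕ) (m : Finset ι → M) (s : Finset ι) :
    koszulShift x e m s = (∏ j ∈ s, x j) ^ e • m s := rfl

theorem koszulShift_zero (x : ι → T) (m : Finset ι → M) : koszulShift x 0 m = m := by
  ext s
  rw [koszulShift_apply, pow_zero, one_smul]

theorem koszulShift_koszulShift (x : ι → T) (e f : ℕ) (m : Finset ι → M) :
    koszulShift x f (koszulShift x e m) = koszulShift x (e + f) m := by
  ext s
  rw [koszulShift_apply, koszulShift_apply, koszulShift_apply, smul_smul, ← pow_add, add_comm]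

theorem comp_koszulShift {U N : Type*} [CommRing U] [AddCommGroup N] [Module U N] {x : ι → T}
    {y : ι → U} {h : M → N} (hxy : ∀ j m, h (x j • m) = y j • h m) (e : ℕ) (m : Finset ι → M) :
    h ∘ koszulShift x e m = koszulShift y e (h ∘ m) := by
  classical
  ext s
  refine map_pow_smul_of_map_smul (fun m => ?_) e (m s)
  induction s using Finset.induction_on generalizing m with
  | empty => simp only [Finset.prod_empty, one_smul]
  | insert j s hj ih => simp only [Finset.prod_insert hj, mul_smul, hxy, ih]

end Shift

section Koszul

variable {ι : Type*} [LinearOrder ι]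

/-- The sign attached to the position of `j` in `t`. -/
def posSign (j : ι) (t : Finset ι) : ℤ := (-1) ^ (t.filter (· < j)).card

theorem posSign_mul_self (j : ι) (t : Finset ι) : posSign j t * posSign j t = 1 := by
  rw [posSign, ← mul_pow, neg_one_mul, neg_neg, one_pow]

theorem posSign_erase_of_not_lt {j l : ι} (t : Finset ι) (h : ¬ l < j) :
    posSign j (t.erase l) = posSign j t := by
  rw [posSign, posSign, Finset.filter_erase, Finset.erase_eq_of_notMem]
  exact fun hl => h (Finset.mem_filter.1 hl).2

theorem posSign_erase_of_lt {j l : ι} {t : Finset ι} (h : l < j) (hl : l ∈ t) :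
    posSign j (t.erase l) = -posSign j t := by
  have hmem : l ∈ t.filter (· < j) := Finset.mem_filter.2 ⟨hl, h⟩
  rw [posSign, posSign, Finset.filter_erase, ← Finset.card_erase_add_one hmem, pow_succ]
  ring

theorem posSign_mul_posSign_erase {j l : ι} {t : Finset ι} (hj : j ∈ t) (hl : l ∈ t)
    (hne : j ≠ l) :
    posSign l t * posSign j (t.erase l) = -(posSign j t * posSign l (t.erase j)) := by
  rcases lt_or_gt_of_ne hne with h | h
  · rw [posSign_erase_of_not_lt t h.not_gt, posSign_erase_of_lt h hj]; ring
  · rw [posSign_erase_of_not_lt t h.not_gt, posSign_erase_of_lt h hl]; ring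

variable {T : Type*} [CommRing T] {M : Type*} [AddCommGroup M] [Module T M]

/-- The differential of the Koszul cochain complex of the sequence `x`. A cochain of degree `i` is
a family indexed by the subsets of cardinality `i`; families indexed by all subsets carry the
cochains of all degrees at once. -/
def koszulD (x : ι → T) : (Finset ι → M) →ₗ[T] (Finset ι → M) :=
  LinearMap.pi fun t => ∑ j ∈ t, posSign j t • x j • LinearMap.proj (t.erase j)

theorem koszulD_apply (x : ι → T) (m : Finset ι → M) (t : Finset ι) :
    koszulD x m t = ∑ j ∈ t, posSign j t • x j • m (t.erase j) := by
  simp only [koszulD, LinearMap.pi_apply, LinearMap.sum_apply, LinearMap.smul_apply,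
    LinearMap.proj_apply]

theorem koszulD_empty (x : ι → T) (m : Finset ι → M) : koszulD x m ∅ = 0 := by
  rw [koszulD_apply, Finset.sum_empty]

theorem koszulD_congr (x : ι → T) {m m' : Finset ι → M} {i : ℕ}
    (h : ∀ s : Finset ι, s.card = i → m s = m' s) {t : Finset ι} (ht : t.card = i + 1) :
    koszulD x m t = koszulD x m' t := by
  simp only [koszulD_apply]
  refine Finset.sum_congr rfl fun j hj => ?_
  rw [h _ (by rw [Finset.card_erase_of_mem hj, ht, Nat.add_sub_cancel])]

theorem koszulD_koszulD (x : ι → T) (m : Finset ι → M) : koszulD x (koszulD x m) = 0 := by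
  ext t
  simp only [koszulD_apply, Finset.smul_sum, Pi.zero_apply, Finset.sum_sigma']
  -- removing `j` and then `l` cancels against removing `l` and then `j`
  refine Finset.sum_involution (fun a _ => ⟨a.2, a.1⟩) ?_ ?_ ?_ fun _ _ => rfl
  · rintro ⟨j, l⟩ h
    obtain ⟨hj, hlj, hl⟩ : j ∈ t ∧ l ≠ j ∧ l ∈ t := by simpa using h
    simp only
    rw [Finset.erase_right_comm (a := l) (b := j), smul_comm (x j) (posSign l _),
      smul_comm (x l) (posSign j _), smul_smul, smul_smul, smul_smul, smul_smul,
      posSign_mul_posSign_erase hj hl hlj.symm, mul_comm (x l), neg_smul, add_neg_cancel]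
  · rintro ⟨j, l⟩ h _ e
    simp only [Finset.mem_sigma, Finset.mem_erase] at h
    exact h.2.1 (congrArg Sigma.fst e)
  · rintro ⟨j, l⟩ h
    simp only [Finset.mem_sigma, Finset.mem_erase] at h ⊢
    exact ⟨h.2.2, h.2.1.symm, h.1⟩

/-- Contraction of a Koszul cochain with the `j`-th basis vector, the homotopy between
multiplication by `x j` and zero. -/
def koszulContract (j : ι) (m : Finset ι → M) : Finset ι → M := fun s =>
  if j ∈ s then 0 else posSign j (insert j s) • m (insert j s)

theorem koszulD_koszulContract (x : ι → T) (j : ι) (m : Finset ι → M) (t : Finset ι) :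
    koszulD x (koszulContract j m) t + koszulContract j (koszulD x m) t = x j • m t := by
  by_cases hj : j ∈ t
  · rw [koszulContract, if_pos hj, add_zero, koszulD_apply, Finset.sum_eq_single_of_mem j hj]
    · rw [koszulContract, if_neg (Finset.notMem_erase j t), Finset.insert_erase hj,
        smul_comm (x j), smul_smul, posSign_mul_self, one_smul]
    · intro l _ hlj
      rw [koszulContract, if_pos (Finset.mem_erase.2 ⟨hlj.symm, hj⟩), smul_zero, smul_zero]
  · have hcancel : ∀ l ∈ t, posSign l t • x l • koszulContract j m (t.erase l) =
        -(posSign j (insert j t) • posSign l (insert j t) • x l • m ((insert j t).erase l)) := by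
      intro l hl
      have hlj : l ≠ j := fun h => hj (h ▸ hl)
      have hsign : posSign l t * posSign j ((insert j t).erase l) =
          -(posSign j (insert j t) * posSign l (insert j t)) := by
        have h := posSign_mul_posSign_erase (Finset.mem_insert_self j t)
          (Finset.mem_insert_of_mem hl) hlj.symm
        rw [Finset.erase_insert hj] at h
        linear_combination posSign j (insert j t) * posSign j ((insert j t).erase l) * h
          - posSign j (insert j t) * posSign l (insert j t) *
            posSign_mul_self j ((insert j t).erase l)
          - posSign l t * posSign j ((insert j t).erase l) * posSign_mul_self j (insert j t)
      rw [koszulContract, if_neg fun h => hj (Finset.mem_of_mem_erase h),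
        ← Finset.erase_insert_of_ne hlj.symm, smul_comm (x l), smul_smul, smul_smul, ← neg_smul,
        hsign]
    rw [koszulContract, if_neg hj, koszulD_apply, koszulD_apply, Finset.sum_insert hj,
      Finset.erase_insert hj, smul_add, Finset.smul_sum, smul_smul, posSign_mul_self, one_smul,
      Finset.sum_congr rfl hcancel, Finset.sum_neg_distrib]
    abel

/-- The Koszul cocycles of degree `i`. -/
def koszulCocycles (x : ι → T) (M : Type*) [AddCommGroup M] [Module T M] (i : ℕ) :
    Submodule T (Finset ι → M) where
  carrier := {m | ∀ t : Finset ι, t.card = i + 1 → koszulD x m t = 0}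
  zero_mem' t _ := by rw [map_zero, Pi.zero_apply]
  add_mem' hm hm' t ht := by rw [map_add, Pi.add_apply, hm t ht, hm' t ht, add_zero]
  smul_mem' c m hm t ht := by rw [map_smul, Pi.smul_apply, hm t ht, smul_zero]

/-- The families that agree in degree `i` with a Koszul coboundary. -/
def koszulCoboundaries (x : ι → T) (M : Type*) [AddCommGroup M] [Module T M] (i : ℕ) :
    Submodule T (Finset ι → M) where
  carrier := {m | ∃ w, ∀ s : Finset ι, s.card = i → m s = koszulD x w s}
  zero_mem' := ⟨0, fun s _ => by rw [map_zero]⟩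
  add_mem' := fun ⟨w, hw⟩ ⟨w', hw'⟩ => ⟨w + w', fun s hs => by
    rw [map_add, Pi.add_apply, Pi.add_apply, hw s hs, hw' s hs]⟩
  smul_mem' := fun c _ ⟨w, hw⟩ => ⟨c • w, fun s hs => by
    rw [map_smul, Pi.smul_apply, Pi.smul_apply, hw s hs]⟩

variable {x : ι → T} {m : Finset ι → M} {i : ℕ}

theorem smul_mem_koszulCoboundaries (hm : m ∈ koszulCocycles x M i) (j : ι) :
    x j • m ∈ koszulCoboundaries x M i := by
  refine ⟨koszulContract j m, fun s hs => ?_⟩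
  rw [Pi.smul_apply, ← koszulD_koszulContract, add_eq_left, koszulContract]
  split_ifs with hj
  · rfl
  · rw [hm _ (by rw [Finset.card_insert_of_notMem hj, hs]), smul_zero]

theorem exists_pow_smul_mem_koszulCoboundaries {a : ℕ} (hm : m ∈ koszulCocycles (x ^ a) M i)
    {y : T} (hy : y ∈ (Ideal.span (Set.range x)).radical) :
    ∃ k : ℕ, y ^ k • m ∈ koszulCoboundaries (x ^ a) M i := by
  let J : Ideal T := (koszulCoboundaries (x ^ a) M i).comap (LinearMap.toSpanSingleton T _ m)
  have hJ : Ideal.span (Set.range x) ≤ J.radical :=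
    Ideal.span_le.2 <| Set.range_subset_iff.2 fun j => ⟨a, smul_mem_koszulCoboundaries hm j⟩
  exact Ideal.radical_le_radical_iff.2 hJ hy

section Map

variable {U N F : Type*} [CommRing U] [AddCommGroup N] [Module U N] [FunLike F M N]
  [AddMonoidHomClass F M N] {y : ι → U} (h : F) (hxy : ∀ j m, h (x j • m) = y j • h m)

include hxy

theorem map_koszulD (m : Finset ι → M) (t : Finset ι) :
    h (koszulD x m t) = koszulD y (h ∘ m) t := by
  simp only [koszulD_apply, map_sum, map_zsmul, hxy, Function.comp_apply]

theorem comp_mem_koszulCocycles (hm : m ∈ koszulCocycles x M i) :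
    h ∘ m ∈ koszulCocycles y N i := fun t ht => by
  rw [← map_koszulD h hxy, hm t ht, map_zero]

theorem mem_koszulCocycles_of_comp_mem (hinj : Function.Injective h)
    (hm : h ∘ m ∈ koszulCocycles y N i) : m ∈ koszulCocycles x M i := fun t ht => by
  apply hinj
  rw [map_koszulD h hxy, hm t ht, map_zero]

theorem comp_mem_koszulCoboundaries (hm : m ∈ koszulCoboundaries x M i) :
    h ∘ m ∈ koszulCoboundaries y N i := by
  obtain ⟨w, hw⟩ := hm
  exact ⟨h ∘ w, fun s hs => by rw [Function.comp_apply, hw s hs, map_koszulD h hxy]⟩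

theorem mem_koszulCoboundaries_of_comp_mem (hbij : Function.Bijective h)
    (hm : h ∘ m ∈ koszulCoboundaries y N i) : m ∈ koszulCoboundaries x M i := by
  obtain ⟨w, hw⟩ := hm
  obtain ⟨u, rfl⟩ := hbij.surjective.comp_left w
  exact ⟨u, fun s hs => hbij.injective <| by rw [map_koszulD h hxy, ← hw s hs, Function.comp_apply]⟩

end Map

theorem koszulD_koszulShift (x : ι → T) (a e : ℕ) (m : Finset ι → M) :
    koszulD (x ^ (a + e)) (koszulShift x e m) = koszulShift x e (koszulD (x ^ a) m) := by
  ext t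
  simp only [koszulD_apply, koszulShift_apply, Finset.smul_sum]
  refine Finset.sum_congr rfl fun j hj => ?_
  rw [smul_comm _ (posSign j t), smul_smul, smul_smul, ← Finset.mul_prod_erase t x hj,
    Pi.pow_apply, Pi.pow_apply, mul_pow, pow_add]
  congr 2
  ring

/-- The degree `i` cohomology of the direct limit of the Koszul complexes of the sequences `x ^ a`
with coefficients in `M` vanishes. -/
def KoszulLimitVanishes (x : ι → T) (M : Type*) [AddCommGroup M] [Module T M] (i : ℕ) : Prop :=
  ∀ (a : ℕ), ∀ m ∈ koszulCocycles (x ^ a) M i,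
    ∃ e : ℕ, koszulShift x e m ∈ koszulCoboundaries (x ^ (a + e)) M i

end Koszul

section KoszulLimit

variable {ι T M : Type*} [LinearOrder ι] [CommRing T] [AddCommGroup M] [Module T M] {x : ι → T}
  {y : T} {a i : ℕ}

theorem exists_eq_koszulD_add_smul {w : Finset ι → M}
    (hw : (y • (⊤ : Submodule T M)).mkQ ∘ w ∈ koszulCoboundaries x (QuotSMulTop y M) i) :
    ∃ u t : Finset ι → M, ∀ s : Finset ι, s.card = i → w s = koszulD x u s + y • t s := by
  let π : M →ₗ[T] QuotSMulTop y M := (y • (⊤ : Submodule T M)).mkQ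
  obtain ⟨u, hu⟩ := hw
  obtain ⟨u, rfl⟩ := (Submodule.mkQ_surjective (y • (⊤ : Submodule T M))).comp_left u
  have hex : ∀ s : Finset ι, ∃ t : M, s.card = i → w s = koszulD x u s + y • t := by
    intro s
    by_cases hs : s.card = i
    · have h0 : π (w s - koszulD x u s) = 0 := by
        rw [map_sub, map_koszulD π fun _ _ => map_smul π _ _]
        exact sub_eq_zero.2 (hu s hs)
      obtain ⟨t, -, ht⟩ := (Submodule.mem_smul_pointwise_iff_exists _ _ _).1
        ((Submodule.Quotient.mk_eq_zero _).1 h0)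
      exact ⟨t, fun _ => by rw [ht, add_sub_cancel]⟩
    · exact ⟨0, fun h => absurd h hs⟩
  choose t ht using hex
  exact ⟨u, t, ht⟩

/-- The connecting homomorphism of `0 → M → M → M / y M → 0`: if `y • m` is a coboundary of `w`,
then `w` is a cocycle modulo `y`. -/
theorem exists_koszulShift_mem_koszulCoboundaries_of_smul (hy : IsSMulRegular M y)
    (hv : ∀ k, i = k + 1 → KoszulLimitVanishes x (QuotSMulTop y M) k) {m : Finset ι → M}
    (h : y • m ∈ koszulCoboundaries (x ^ a) M i) :
    ∃ e, koszulShift x e m ∈ koszulCoboundaries (x ^ (a + e)) M i := by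
  obtain ⟨w, hw⟩ := h
  rcases i with - | k
  · refine ⟨0, 0, fun s hs => hy ?_⟩
    obtain rfl := Finset.card_eq_zero.1 hs
    simpa only [koszulShift_zero, koszulD_empty, smul_zero, Pi.smul_apply] using hw ∅ hs
  let π : M →ₗ[T] QuotSMulTop y M := (y • (⊤ : Submodule T M)).mkQ
  have hπ : ∀ {x : ι → T} j m, π (x j • m) = x j • π m := fun _ _ => map_smul π _ _
  have hcocycle : π ∘ w ∈ koszulCocycles (x ^ a) (QuotSMulTop y M) k := fun t ht => by
    rw [← map_koszulD π hπ, ← hw t ht]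
    exact (Submodule.Quotient.mk_eq_zero _).2 (Submodule.smul_mem_pointwise_smul _ _ _ trivial)
  obtain ⟨e, he⟩ := hv k rfl a _ hcocycle
  rw [← comp_koszulShift hπ] at he
  obtain ⟨u, t, ht⟩ := exists_eq_koszulD_add_smul he
  refine ⟨e, t, fun s hs => hy ?_⟩
  simp only
  calc y • koszulShift x e m s = koszulShift x e (koszulD (x ^ a) w) s := by
        rw [koszulShift_apply, koszulShift_apply, ← hw s hs, Pi.smul_apply, smul_comm]
    _ = koszulD (x ^ (a + e)) (koszulShift x e w) s := by rw [koszulD_koszulShift]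
    _ = koszulD (x ^ (a + e)) (koszulD (x ^ (a + e)) u + y • t) s := koszulD_congr _ ht hs
    _ = y • koszulD (x ^ (a + e)) t s := by
        rw [map_add, koszulD_koszulD, zero_add, map_smul, Pi.smul_apply]

theorem KoszulLimitVanishes.of_quotSMulTop (hyx : y ∈ (Ideal.span (Set.range x)).radical)
    (hy : IsSMulRegular M y)
    (hv : ∀ k, i = k + 1 → KoszulLimitVanishes x (QuotSMulTop y M) k) :
    KoszulLimitVanishes x M i := by
  have hpow : ∀ (k a : ℕ) (m : Finset ι → M), y ^ k • m ∈ koszulCoboundaries (x ^ a) M i →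
      ∃ e, koszulShift x e m ∈ koszulCoboundaries (x ^ (a + e)) M i := by
    intro k
    induction k with
    | zero => exact fun a m hm => ⟨0, by simpa [koszulShift_zero] using hm⟩
    | succ k ih =>
      intro a m hm
      rw [pow_succ', mul_smul] at hm
      obtain ⟨e, he⟩ := exists_koszulShift_mem_koszulCoboundaries_of_smul hy hv hm
      rw [map_smul] at he
      obtain ⟨f, hf⟩ := ih (a + e) _ he
      exact ⟨e + f, by rwa [koszulShift_koszulShift, add_assoc] at hf⟩
  intro a m hm
  obtain ⟨k, hk⟩ := exists_pow_smul_mem_koszulCoboundaries hm hyx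
  exact hpow k a m hk

theorem koszulLimitVanishes_of_le_radical_annihilator [Finite ι] (hi : i ≠ 0)
    (hx : Ideal.span (Set.range x) ≤ (Module.annihilator T M).radical) :
    KoszulLimitVanishes x M i := by
  obtain ⟨k, hk⟩ := Ideal.exists_pow_le_of_le_radical_of_fg hx
    (Submodule.fg_span (Set.finite_range x))
  refine fun a m _ => ⟨k, 0, fun s hs => ?_⟩
  obtain ⟨j, hj⟩ : s.Nonempty := Finset.card_ne_zero.1 (hs ▸ hi)
  have hprod : ∏ j ∈ s, x j ∈ Ideal.span (Set.range x) :=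
    Ideal.mem_of_dvd _ (Finset.dvd_prod_of_mem x hj) (Ideal.subset_span ⟨j, rfl⟩)
  rw [koszulShift_apply, Module.mem_annihilator.1 (hk (Ideal.pow_mem_pow hprod k)), map_zero,
    Pi.zero_apply]

/-- Depth sensitivity; `hx` says that `M / (rs) M` is supported on the zero set of `(x)`. -/
theorem koszulLimitVanishes_of_isWeaklyRegular [Finite ι] (rs : List T)
    (hrs : Ideal.ofList rs ≤ (Ideal.span (Set.range x)).radical)
    (hreg : RingTheory.Sequence.IsWeaklyRegular M rs)
    (hx : Ideal.span (Set.range x) ≤ (Ideal.ofList rs ⊔ Module.annihilator T M).radical)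
    (hi : i ≠ rs.length) : KoszulLimitVanishes x M i := by
  induction rs generalizing M i with
  | nil =>
    rw [Ideal.ofList_nil, bot_sup_eq] at hx
    exact koszulLimitVanishes_of_le_radical_annihilator hi hx
  | cons y rs ih =>
    rw [RingTheory.Sequence.isWeaklyRegular_cons_iff] at hreg
    rw [Ideal.ofList_cons, sup_le_iff, Ideal.span_singleton_le_iff_mem] at hrs
    have hann : Ideal.ofList (y :: rs) ⊔ Module.annihilator T M ≤
        Ideal.ofList rs ⊔ Module.annihilator T (QuotSMulTop y M) := by
      rw [Ideal.ofList_cons, sup_comm (Ideal.span {y}), sup_assoc]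
      refine sup_le_sup_left (sup_le ?_ ?_) _
      · exact (Ideal.span_singleton_le_iff_mem _).2 (QuotSMulTop.mem_annihilator M y)
      · exact LinearMap.annihilator_le_of_surjective (y • (⊤ : Submodule T M)).mkQ
          (Submodule.mkQ_surjective _)
    refine .of_quotSMulTop hrs.1 hreg.1 fun k hk => ?_
    exact ih hrs.2 hreg.2 (hx.trans (Ideal.radical_mono hann)) fun h => hi (by simp [hk, h])

end KoszulLimit

section CechFractions

variable {T : Type*} [CommRing T] {n : ℕ} (x : Fin n → T) {M : Type*} [AddCommGroup M] [Module T M]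

/-- The map `m ↦ m / (∏ j ∈ s, x j) ^ a`. -/
noncomputable def cechFrac (a : ℕ) (s : Finset (Fin n)) : M →ₗ[T] CechLoc x M s :=
  (LocalizedModule.divBy ⟨(∏ j ∈ s, x j) ^ a, pow_mem (Submonoid.mem_powers _) a⟩).comp
    (LocalizedModule.mkLinearMap (Submonoid.powers (∏ j ∈ s, x j)) M)

theorem cechFrac_apply (a : ℕ) (s : Finset (Fin n)) (m : M) :
    cechFrac x a s m =
      LocalizedModule.mk m ⟨(∏ j ∈ s, x j) ^ a, pow_mem (Submonoid.mem_powers _) a⟩ := by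
  simp only [cechFrac, LinearMap.comp_apply, LocalizedModule.mkLinearMap_apply,
    LocalizedModule.divBy_apply, LocalizedModule.liftOn_mk, one_mul]

theorem cechFrac_pow_smul (a : ℕ) (s : Finset (Fin n)) (m : M) :
    cechFrac x a s ((∏ j ∈ s, x j) ^ a • m) =
      LocalizedModule.mkLinearMap (Submonoid.powers (∏ j ∈ s, x j)) M m := by
  rw [cechFrac_apply, LocalizedModule.mkLinearMap_apply]
  exact LocalizedModule.mk_cancel ⟨(∏ j ∈ s, x j) ^ a, pow_mem (Submonoid.mem_powers _) a⟩ m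

theorem cechFrac_add_koszulShift (a e : ℕ) (s : Finset (Fin n)) (m : Finset (Fin n) → M) :
    cechFrac x (a + e) s (koszulShift x e m s) = cechFrac x a s (m s) := by
  rw [koszulShift_apply, cechFrac_apply, cechFrac_apply, LocalizedModule.mk_eq]
  exact ⟨1, by simp only [one_smul, Submonoid.smul_def, smul_smul, pow_add]⟩

theorem exists_cechFrac_eq (s : Finset (Fin n)) (z : CechLoc x M s) :
    ∃ (a : ℕ) (m : M), cechFrac x a s m = z := by
  induction z using LocalizedModule.induction_on with
  | h m d =>
    obtain ⟨_, a, rfl⟩ := d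
    exact ⟨a, m, cechFrac_apply x a s m⟩

theorem exists_pow_smul_eq_zero_of_cechFrac_eq_zero {a : ℕ} {s : Finset (Fin n)} {m : M}
    (h : cechFrac x a s m = 0) : ∃ e : ℕ, (∏ j ∈ s, x j) ^ e • m = 0 := by
  rw [cechFrac_apply, ← LocalizedModule.zero_mk 1, LocalizedModule.mk_eq] at h
  obtain ⟨⟨_, e, rfl⟩, h⟩ := h
  exact ⟨e, by simpa [Submonoid.smul_def] using h⟩

theorem cechRes_cechFrac (a : ℕ) {s t : Finset (Fin n)} (h : s ⊆ t) (m : M) :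
    cechRes x M h (cechFrac x a s m) = cechFrac x a t ((∏ j ∈ t \ s, x j) ^ a • m) := by
  have hunit := isUnit_end_cechLoc (M := M) x h
    ⟨(∏ j ∈ s, x j) ^ a, pow_mem (Submonoid.mem_powers _) a⟩
  apply ((Module.End.isUnit_iff _).1 hunit).1
  simp only [Module.algebraMap_end_apply]
  rw [← map_smul, ← map_smul, ← map_smul, cechFrac_pow_smul, smul_smul, ← mul_pow, mul_comm,
    Finset.prod_sdiff h, cechFrac_pow_smul, LocalizedModule.mkLinearMap_apply]
  exact LocalizedModule.lift_mk_one _ _ _ _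

/-- The Čech cochain of degree `i` with components `m s / (∏ j ∈ s, x j) ^ a`. -/
noncomputable def cechFracCochain (a i : ℕ) : (Finset (Fin n) → M) →ₗ[T] CechCochain x M i :=
  LinearMap.pi fun s => cechFrac x a s.1 ∘ₗ LinearMap.proj s.1

theorem cechFracCochain_apply (a i : ℕ) (m : Finset (Fin n) → M)
    (s : {s : Finset (Fin n) // s.card = i}) :
    cechFracCochain x a i m s = cechFrac x a s.1 (m s.1) := rfl

theorem cechFracCochain_add_koszulShift (a e i : ℕ) (m : Finset (Fin n) → M) :
    cechFracCochain x (a + e) i (koszulShift x e m) = cechFracCochain x a i m :=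
  funext fun s => cechFrac_add_koszulShift x a e s.1 m

theorem cechD_cechFracCochain (a i : ℕ) (m : Finset (Fin n) → M) :
    cechD x M i (cechFracCochain x a i m) = cechFracCochain x a (i + 1) (koszulD (x ^ a) m) := by
  ext t
  rw [cechFracCochain_apply, koszulD_apply, map_sum, ← Finset.sum_coe_sort]
  simp only [cechD, LinearMap.pi_apply, LinearMap.sum_apply]
  refine Finset.sum_congr rfl fun j _ => ?_
  change posSign j.1 t.1 • cechRes x M (Finset.erase_subset j.1 t.1) (cechFrac x a _ _) = _
  rw [cechRes_cechFrac, map_zsmul, Finset.sdiff_erase_self j.2, Finset.prod_singleton]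
  rfl

theorem exists_cechFracCochain_eq (i : ℕ) (z : CechCochain x M i) :
    ∃ (a : ℕ) (m : Finset (Fin n) → M), cechFracCochain x a i m = z := by
  choose a m h using fun s : {s : Finset (Fin n) // s.card = i} => exists_cechFrac_eq x s.1 (z s)
  let b : ℕ := ∑ s, a s
  refine ⟨b, fun s => if hs : s.card = i then
    (∏ j ∈ s, x j) ^ (b - a ⟨s, hs⟩) • m ⟨s, hs⟩ else 0, funext fun s => ?_⟩
  have hle : a s ≤ b := Finset.single_le_sum (fun _ _ => Nat.zero_le _) (Finset.mem_univ s)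
  rw [← h s, cechFracCochain_apply, dif_pos s.2]
  simpa only [Nat.add_sub_cancel' hle, koszulShift_apply] using
    cechFrac_add_koszulShift x (a s) (b - a s) s.1 fun _ => m s

theorem exists_cechFracCochain_eq_of_cechD_eq_zero {i : ℕ} {z : CechCochain x M i}
    (hz : cechD x M i z = 0) :
    ∃ (a : ℕ), ∃ m ∈ koszulCocycles (x ^ a) M i, cechFracCochain x a i m = z := by
  obtain ⟨a, m, rfl⟩ := exists_cechFracCochain_eq x i z
  rw [cechD_cechFracCochain] at hz
  have hex (t : {t : Finset (Fin n) // t.card = i + 1}) :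
      ∃ e : ℕ, (∏ j ∈ t.1, x j) ^ e • koszulD (x ^ a) m t.1 = 0 :=
    exists_pow_smul_eq_zero_of_cechFrac_eq_zero x (congrFun hz t)
  choose e he using hex
  let f : ℕ := ∑ t, e t
  refine ⟨a + f, koszulShift x f m, fun t ht => ?_, cechFracCochain_add_koszulShift x a f i m⟩
  have hle : e ⟨t, ht⟩ ≤ f :=
    Finset.single_le_sum (fun _ _ => Nat.zero_le _) (Finset.mem_univ (⟨t, ht⟩ : Subtype _))
  rw [koszulD_koszulShift, koszulShift_apply, ← Nat.sub_add_cancel hle, pow_add, mul_smul,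
    he ⟨t, ht⟩, smul_zero]

theorem cechFracCochain_mem_cechB {a i : ℕ} {m : Finset (Fin n) → M}
    (hm : m ∈ koszulCoboundaries (x ^ a) M i) : cechFracCochain x a i m ∈ cechB x M i := by
  obtain ⟨w, hw⟩ := hm
  have hcongr : cechFracCochain x a i m = cechFracCochain x a i (koszulD (x ^ a) w) :=
    funext fun s => congrArg (cechFrac x a s.1) (hw s.1 s.2)
  rw [hcongr]
  rcases i with - | k
  · refine (Submodule.mem_bot T).2 (funext fun ⟨s, hs⟩ => ?_)
    obtain rfl := Finset.card_eq_zero.1 hs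
    rw [cechFracCochain_apply, koszulD_empty, map_zero, Pi.zero_apply]
  · exact ⟨cechFracCochain x a k w, cechD_cechFracCochain x a k w⟩

theorem almostZero_cechCohomology (v : ValueMap T) {i : ℕ}
    (h : ∀ (a : ℕ), ∀ m ∈ koszulCocycles (x ^ a) M i, ∀ ε : ℝ, 0 < ε →
      ∃ b : T, v b < (ε : WithTop ℝ) ∧
        ∃ e : ℕ, b • koszulShift x e m ∈ koszulCoboundaries (x ^ (a + e)) M i) :
    AlmostZero v (CechCohomology x M i) := by
  intro z ε hε
  obtain ⟨⟨z, hz⟩, rfl⟩ := Submodule.Quotient.mk_surjective _ z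
  obtain ⟨a, m, hm, rfl⟩ := exists_cechFracCochain_eq_of_cechD_eq_zero x hz
  obtain ⟨b, hb, e, he⟩ := h a m hm ε hε
  refine ⟨b, ?_, hb⟩
  rw [← Submodule.Quotient.mk_smul, Submodule.Quotient.mk_eq_zero]
  have hmem := cechFracCochain_mem_cechB x he
  rwa [map_smul, cechFracCochain_add_koszulShift] at hmem

end CechFractions

section RegularLocalRing

open IsLocalRing RingTheory.Sequence

theorem exists_mem_maximalIdeal_notMem_sq_notMem_minimalPrimes (R : Type*) [CommRing R]
    [IsLocalRing R] [IsNoetherianRing R] (h : 0 < ringKrullDim R) :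
    ∃ x ∈ maximalIdeal R, x ∉ maximalIdeal R ^ 2 ∧ ∀ P ∈ minimalPrimes R, x ∉ P := by
  have hht : 0 < (maximalIdeal R).height := by
    rw [← maximalIdeal_height_eq_ringKrullDim] at h
    exact_mod_cast h
  by_contra! hc
  have hsub : (maximalIdeal R : Set R) ⊆
      ⋃ P ∈ insert (maximalIdeal R ^ 2) (minimalPrimes R), (P : Set R) := by
    intro x hx
    simp only [Set.mem_iUnion]
    by_cases hx2 : x ∈ maximalIdeal R ^ 2
    · exact ⟨_, Set.mem_insert _ _, hx2⟩
    · obtain ⟨P, hP, hxP⟩ := hc x hx hx2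
      exact ⟨P, Set.mem_insert_of_mem _ hP, hxP⟩
  obtain ⟨P, hP, hle⟩ := (Ideal.subset_union_prime_finite (f := id)
    ((minimalPrimes.finite_of_isNoetherianRing R).insert _) (maximalIdeal R ^ 2)
    (maximalIdeal R ^ 2) (fun P hP hne _ => by
      rcases hP with rfl | hP
      · exact absurd rfl hne
      · exact hP.1.1)).1 hsub
  rcases hP with rfl | hP
  · have h0 : maximalIdeal R = ⊥ := by
      refine Submodule.eq_bot_of_le_smul_of_le_jacobson_bot (maximalIdeal R) (maximalIdeal R)
        (IsNoetherian.noetherian _) ?_ (maximalIdeal_le_jacobson _)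
      simpa [sq] using hle
    rw [h0, Ideal.height_bot] at hht
    exact lt_irrefl _ hht
  · have hPp : P.IsPrime := hP.1.1
    exact (hht.trans_le (Ideal.height_mono (J := P) hle)).ne' (Ideal.height_eq_zero_iff.2 hP)

theorem exists_span_singleton_sup_span_eq_maximalIdeal {R : Type*} [CommRing R] [IsLocalRing R]
    {n : ℕ} {g : Fin (n + 1) → R} (hg : Ideal.span (Set.range g) = maximalIdeal R) {x : R}
    (hx : x ∈ maximalIdeal R) (hx2 : x ∉ maximalIdeal R ^ 2) :
    ∃ g' : Fin n → R, Ideal.span {x} ⊔ Ideal.span (Set.range g') = maximalIdeal R := by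
  have hgm : ∀ i, g i ∈ maximalIdeal R := fun i => hg ▸ Ideal.subset_span ⟨i, rfl⟩
  obtain ⟨c, hc⟩ := (Ideal.mem_span_range_iff_exists_fun).1 (hg ▸ hx)
  have : ∃ i, IsUnit (c i) := by
    by_contra! h
    refine hx2 (hc ▸ Ideal.sum_mem _ fun i _ => ?_)
    rw [sq]
    exact Ideal.mul_mem_mul ((mem_maximalIdeal _).2 (h i)) (hgm i)
  obtain ⟨i, hi⟩ := this
  refine ⟨fun j => g (i.succAbove j), le_antisymm (sup_le ?_ ?_) ?_⟩
  · rwa [Ideal.span_singleton_le_iff_mem]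
  · rw [Ideal.span_le]
    rintro _ ⟨j, rfl⟩
    exact hgm _
  · rw [← hg, Ideal.span_le]
    have hmem : ∀ j, g (i.succAbove j) ∈
        Ideal.span {x} ⊔ Ideal.span (Set.range fun j => g (i.succAbove j)) :=
      fun j => Ideal.mem_sup_right (Ideal.subset_span ⟨j, rfl⟩)
    rintro _ ⟨k, rfl⟩
    rcases Fin.eq_self_or_eq_succAbove i k with rfl | ⟨j, rfl⟩
    · rw [Fin.sum_univ_succAbove _ k] at hc
      have : c k * g k ∈ Ideal.span {x} ⊔ Ideal.span (Set.range fun j => g (k.succAbove j)) := by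
        rw [eq_sub_of_add_eq hc]
        refine Ideal.sub_mem _ (Ideal.mem_sup_left (Ideal.mem_span_singleton_self x)) ?_
        exact Ideal.sum_mem _ fun j _ => Ideal.mul_mem_left _ _ (hmem j)
      exact (Ideal.unit_mul_mem_iff_mem _ hi).1 this
    · exact hmem j

theorem isDomain_of_isPrime_span_singleton {R : Type*} [CommRing R] [IsLocalRing R]
    [IsNoetherianRing R] {x : R} (hx : x ∈ maximalIdeal R) (hmin : ∀ P ∈ minimalPrimes R, x ∉ P)
    (hprime : (Ideal.span {x}).IsPrime) : IsDomain R := by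
  obtain ⟨P, hP, hle⟩ := Ideal.exists_minimalPrimes_le (I := (⊥ : Ideal R)) (J := Ideal.span {x})
    bot_le
  have hPp : P.IsPrime := hP.1.1
  have hxP : x ∉ P := hmin P hP
  have h0 : P = ⊥ := by
    refine Submodule.eq_bot_of_le_smul_of_le_jacobson_bot (maximalIdeal R) P
      (IsNoetherian.noetherian _) (fun a ha => ?_) (maximalIdeal_le_jacobson _)
    obtain ⟨b, rfl⟩ := Ideal.mem_span_singleton'.1 (hle ha)
    rw [mul_comm, smul_eq_mul]
    exact Ideal.mul_mem_mul hx ((hPp.mem_or_mem ha).resolve_right hxP)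
  rw [h0] at hPp
  exact IsDomain.of_bot_isPrime R

theorem isRegular_cons_of_quotient {R : Type*} [CommRing R] {x : R} {rs : List R}
    (hx : IsSMulRegular R x)
    (hrs : IsRegular (R ⧸ Ideal.span {x}) (rs.map (Ideal.Quotient.mk (Ideal.span {x})))) :
    IsRegular R (x :: rs) := by
  let e : QuotSMulTop x R ≃ₗ[R] R ⧸ Ideal.span {x} :=
    Submodule.quotEquivOfEq _ _ (by
      rw [← Submodule.ideal_span_singleton_smul, smul_eq_mul, Ideal.mul_top])
  refine IsRegular.cons' hx ((e.toAddEquiv.isRegular_congr ?_).2 hrs)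
  refine List.forall₂_same.2 fun r _ z => ?_
  obtain ⟨r, rfl⟩ := Ideal.Quotient.mk_surjective r
  exact e.map_smul r z

theorem isDomain_and_exists_isRegular_of_span_eq_maximalIdeal {n : ℕ} {R : Type*} [CommRing R]
    [IsLocalRing R] [IsNoetherianRing R] {g : Fin n → R}
    (hg : Ideal.span (Set.range g) = maximalIdeal R) (hn : n ≤ ringKrullDim R) :
    IsDomain R ∧ ∃ rs : List R, rs.length = n ∧ IsRegular R rs := by
  induction n generalizing R with
  | zero =>
    have h0 : maximalIdeal R = ⊥ := by
      rw [← hg, Set.range_eq_empty, Ideal.span_empty]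
    exact ⟨(isField_iff_maximalIdeal_eq.2 h0).isDomain, [], rfl, IsRegular.nil R R⟩
  | succ n ih =>
    obtain ⟨x, hx, hx2, hmin⟩ := exists_mem_maximalIdeal_notMem_sq_notMem_minimalPrimes R
      (lt_of_lt_of_le (by exact_mod_cast Nat.succ_pos n) hn)
    obtain ⟨g', hg'⟩ := exists_span_singleton_sup_span_eq_maximalIdeal hg hx hx2
    have : Nontrivial (R ⧸ Ideal.span {x}) := Ideal.Quotient.nontrivial_iff.2 <|
      ne_top_of_le_ne_top Ideal.IsPrime.ne_top' ((Ideal.span_singleton_le_iff_mem _).2 hx)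
    have : IsLocalRing (R ⧸ Ideal.span {x}) := .of_surjective' _ Ideal.Quotient.mk_surjective
    have hspan : Ideal.span (Set.range (Ideal.Quotient.mk (Ideal.span {x}) ∘ g')) =
        maximalIdeal (R ⧸ Ideal.span {x}) := by
      rw [← map_maximalIdeal_of_surjective _ Ideal.Quotient.mk_surjective, ← hg', Ideal.map_sup,
        Ideal.map_quotient_self, bot_sup_eq, Ideal.map_span, Set.range_comp]
    have hdim : (n : WithBot ℕ∞) ≤ ringKrullDim (R ⧸ Ideal.span {x}) := by
      have h := Ideal.height_le_ringKrullDim_quotient_add_one hx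
      rw [maximalIdeal_height_eq_ringKrullDim] at h
      exact ENat.WithBot.add_le_add_one_right_iff.1 (by exact_mod_cast hn.trans h)
    obtain ⟨hdom, rs, hlen, hreg⟩ := ih hspan hdim
    have hR : IsDomain R := isDomain_of_isPrime_span_singleton hx hmin
      ((Ideal.Quotient.isDomain_iff_prime _).1 hdom)
    have hx0 : x ≠ 0 := fun h => hx2 (h ▸ zero_mem _)
    obtain ⟨rs, rfl⟩ := List.map_surjective_iff.2 Ideal.Quotient.mk_surjective rs
    exact ⟨hR, x :: rs, by simpa using hlen,
      isRegular_cons_of_quotient (.of_ne_zero hx0) hreg⟩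

theorem exists_isRegular_length_eq_ringKrullDim (R : Type*) [CommRing R] [IsRegularLocalRing R] :
    ∃ rs : List R, IsRegular R rs ∧ (rs.length : WithBot ℕ∞) = ringKrullDim R := by
  obtain ⟨g, hg⟩ : ∃ g : Fin (maximalIdeal R).spanFinrank → R,
      Ideal.span (Set.range g) = maximalIdeal R := by
    have hfg : (maximalIdeal R).FG := IsNoetherian.noetherian _
    have : Finite (maximalIdeal R).generators := Submodule.FG.finite_generators hfg
    let e : (maximalIdeal R).generators ≃ Fin (maximalIdeal R).spanFinrank :=
      Finite.equivFinOfCardEq (Submodule.FG.generators_ncard hfg)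
    refine ⟨Subtype.val ∘ e.symm, ?_⟩
    rw [e.symm.surjective.range_comp, Subtype.range_coe]
    exact (maximalIdeal R).span_generators
  obtain ⟨-, rs, hlen, hreg⟩ := isDomain_and_exists_isRegular_of_span_eq_maximalIdeal hg
    (IsRegularLocalRing.spanFinrank_maximalIdeal (R := R)).le
  exact ⟨rs, hreg, by rw [hlen, IsRegularLocalRing.spanFinrank_maximalIdeal]⟩

end RegularLocalRing

section CohenMacaulay

open IsLocalRing RingTheory.Sequence

variable {R : Type*} [CommRing R] [IsLocalRing R] [IsNoetherianRing R] {rs : List R}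

theorem radical_ofList_eq_maximalIdeal_of_isRegular (hrs : IsRegular R rs)
    (hlen : (rs.length : WithBot ℕ∞) = ringKrullDim R) :
    (Ideal.ofList rs).radical = maximalIdeal R := by
  have hne : Ideal.ofList rs ≠ ⊤ := fun h => hrs.top_ne_smul (by rw [h, Submodule.top_smul])
  have : Nontrivial (R ⧸ Ideal.ofList rs) := Ideal.Quotient.nontrivial_iff.2 hne
  have : IsLocalRing (R ⧸ Ideal.ofList rs) := .of_surjective' _ Ideal.Quotient.mk_surjective
  have hdim : Ring.KrullDimLE 0 (R ⧸ Ideal.ofList rs) := by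
    have h := (ringKrullDim_add_length_eq_ringKrullDim_of_isRegular rs hrs).trans hlen.symm
    rw [Ring.krullDimLE_iff]
    exact (ENat.WithBot.add_le_add_natCast_right_iff (c := rs.length)).1 (by
      rw [h, Nat.cast_zero, zero_add])
  have hnil : (⊥ : Ideal (R ⧸ Ideal.ofList rs)).radical = maximalIdeal _ :=
    Ring.KrullDimLE.nilradical_eq_maximalIdeal _
  rw [← Ideal.mk_ker (I := Ideal.ofList rs), RingHom.ker_eq_comap_bot, ← Ideal.comap_radical, hnil]
  exact eq_maximalIdeal (Ideal.comap_isMaximal_of_surjective _ Ideal.Quotient.mk_surjective)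

theorem koszulLimitVanishes_finsupp_of_isRegular (hrs : IsRegular R rs)
    (hlen : (rs.length : WithBot ℕ∞) = ringKrullDim R) (B : Type*) {ι : Type*} [LinearOrder ι]
    [Finite ι] {x : ι → R} (hx : (Ideal.span (Set.range x)).radical = maximalIdeal R) {i : ℕ}
    (hi : (i : WithBot ℕ∞) ≠ ringKrullDim R) : KoszulLimitVanishes x (B →₀ R) i := by
  have hrad := radical_ofList_eq_maximalIdeal_of_isRegular hrs hlen
  refine koszulLimitVanishes_of_isWeaklyRegular rs ?_
    (((TensorProduct.lid R (B →₀ R)).isWeaklyRegular_congr rs).1 hrs.isWeaklyRegular_rTensor) ?_ ?_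
  · exact Ideal.le_radical.trans (hrad.trans hx.symm).le
  · exact (Ideal.le_radical.trans (hx.trans hrad.symm).le).trans (Ideal.radical_mono le_sup_left)
  · rintro rfl
    exact hi hlen

end CohenMacaulay

section FiniteModule

variable (R M : Type*) [CommRing R] [IsDomain R] [AddCommGroup M] [Module R M] [Module.Finite R M]

theorem exists_linearMap_finsupp_comp_eq_smul :
    ∃ (B : Set M) (f : (B →₀ R) →ₗ[R] M) (g : M →ₗ[R] (B →₀ R)) (c : R), c ≠ 0 ∧
      ∀ m, f (g m) = c • m := by
  obtain ⟨B, hB, hmax⟩ := exists_maximal_linearIndepOn R (id : M → M)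
  have hli : LinearIndependent R (Subtype.val : B → M) := hB
  have htors : Module.IsTorsion R (M ⧸ Submodule.span R (Set.range (Subtype.val : B → M))) := by
    intro m
    obtain ⟨m, rfl⟩ := Submodule.Quotient.mk_surjective _ m
    by_cases hm : m ∈ B
    · refine ⟨1, ?_⟩
      rw [one_smul, Submodule.Quotient.mk_eq_zero]
      exact Submodule.subset_span ⟨⟨m, hm⟩, rfl⟩
    · obtain ⟨a, ha, ham⟩ := hmax m hm
      refine ⟨⟨a, mem_nonZeroDivisors_of_ne_zero ha⟩, ?_⟩
      rw [Submonoid.mk_smul, ← Submodule.Quotient.mk_smul, Submodule.Quotient.mk_eq_zero,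
        Subtype.range_coe, ← Set.image_id B]
      exact ham
  obtain ⟨c, hc, hc0⟩ := Submodule.annihilator_top_inter_nonZeroDivisors htors
  have hcB : ∀ m : M, c • m ∈ Submodule.span R (Set.range (Subtype.val : B → M)) := fun m => by
    rw [← Submodule.Quotient.mk_eq_zero, Submodule.Quotient.mk_smul]
    exact Submodule.mem_annihilator.1 hc _ Submodule.mem_top
  refine ⟨B, Finsupp.linearCombination R Subtype.val,
    hli.repr ∘ₗ (LinearMap.lsmul R M c).codRestrict _ hcB, c, nonZeroDivisors.ne_zero hc0,
    fun m => ?_⟩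
  rw [LinearMap.comp_apply]
  exact hli.linearCombination_repr _

variable {R M} in
theorem exists_linearMap_apply_ne_zero {m : M} (hm : ∀ c : R, c ≠ 0 → c • m ≠ 0) :
    ∃ h : M →ₗ[R] R, h m ≠ 0 := by
  obtain ⟨B, f, g, c, hc, hfg⟩ := exists_linearMap_finsupp_comp_eq_smul R M
  have hg : g m ≠ 0 := fun h => hm c hc (by rw [← hfg, h, map_zero])
  obtain ⟨l, hl⟩ := Finsupp.ne_iff.1 hg
  exact ⟨Finsupp.lapply l ∘ₗ g, hl⟩

end FiniteModule

namespace ValueMap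

variable {T : Type*} [CommRing T] (v : ValueMap T)

theorem map_pow_succ (a : T) (n : ℕ) : v (a ^ (n + 1)) = (n + 1) • v a := by
  induction n with
  | zero => rw [zero_add, pow_one, one_nsmul]
  | succ n ih => rw [pow_succ, v.map_mul', ih, ← succ_nsmul]

theorem exists_pow_eq_lt (p : ℕ) [Fact p.Prime] [CharP T p] [PerfectRing T p] {c : T}
    (hc : v c ≠ ⊤) {ε : ℝ} (hε : 0 < ε) (N₀ : ℕ) :
    ∃ N, N₀ ≤ N ∧ ∃ b, b ^ p ^ N = c ∧ v b < (ε : WithTop ℝ) := by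
  obtain ⟨r, hr⟩ := WithTop.ne_top_iff_exists.1 hc
  obtain ⟨k, hk⟩ := Archimedean.arch r hε
  have hp : 1 < p := (Fact.out : p.Prime).one_lt
  obtain ⟨q, hq⟩ : ∃ q, p ^ max N₀ k = q + 1 := Nat.exists_eq_add_one.2 (by positivity)
  obtain ⟨b, hb⟩ := (bijective_iterateFrobenius T p (max N₀ k)).surjective c
  rw [iterateFrobenius_def] at hb
  refine ⟨max N₀ k, le_max_left _ _, b, hb, lt_of_not_ge fun hε' => ?_⟩
  have hkq : k < q + 1 := hq ▸ (Nat.lt_pow_self hp).trans_le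
    (Nat.pow_le_pow_right hp.le (le_max_right N₀ k))
  have hle : (q + 1) • (ε : WithTop ℝ) ≤ r := by
    rw [hr, ← hb, hq, map_pow_succ]
    exact nsmul_le_nsmul_right hε' _
  rw [← WithTop.coe_nsmul, WithTop.coe_le_coe] at hle
  exact (hk.trans_lt (nsmul_lt_nsmul_left hε hkq)).not_ge hle

variable {v}

theorem exists_pos_forall_mem_le (hv : v.IsNormalized) {I : Ideal T} (hI : I.FG) (hne : I ≠ ⊤) :
    ∃ μ : ℝ, 0 < μ ∧ ∀ b ∈ I, (μ : WithTop ℝ) ≤ v b := by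
  induction I, hI using Submodule.fg_induction with
  | singleton y =>
    have hy : 0 < v y := hv.2 y fun h => hne (Ideal.span_singleton_eq_top.2 h)
    obtain ⟨μ, hμ, hle⟩ : ∃ μ : ℝ, 0 < μ ∧ (μ : WithTop ℝ) ≤ v y := by
      induction h : v y with
      | top => exact ⟨1, one_pos, le_top⟩
      | coe r => exact ⟨r, by rwa [h, WithTop.coe_pos] at hy, le_rfl⟩
    refine ⟨μ, hμ, fun b hb => ?_⟩
    obtain ⟨a, rfl⟩ := Ideal.mem_span_singleton'.1 hb
    rw [v.map_mul']
    exact hle.trans (le_add_of_nonneg_left (hv.1 a))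
  | sup I J _ _ ihI ihJ =>
    obtain ⟨μ, hμ, hI⟩ := ihI (ne_top_of_le_ne_top hne le_sup_left)
    obtain ⟨ν, hν, hJ⟩ := ihJ (ne_top_of_le_ne_top hne le_sup_right)
    refine ⟨min μ ν, lt_min hμ hν, fun b hb => ?_⟩
    obtain ⟨y, hy, z, hz, rfl⟩ := Submodule.mem_sup.1 hb
    rw [WithTop.coe_min]
    exact (min_le_min (hI y hy) (hJ z hz)).trans (v.map_add' y z)

theorem not_almostZero_quotient (hv : v.IsNormalized) {I : Ideal T} (hI : I.FG) (hne : I ≠ ⊤)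
    {M : Type*} [AddCommGroup M] [Module T M] (m : M)
    (hm : ∀ b : T, b • m ∈ I • (⊤ : Submodule T M) → ∀ ε : ℝ, 0 < ε →
      ∃ u : T, v u < (ε : WithTop ℝ) ∧ u * b ∈ I) :
    ¬ AlmostZero v (M ⧸ I • (⊤ : Submodule T M)) := by
  obtain ⟨μ, hμ, hle⟩ := exists_pos_forall_mem_le hv hI hne
  intro h
  obtain ⟨b, hb, hvb⟩ := h (Submodule.Quotient.mk m) (μ / 2) (half_pos hμ)
  rw [← Submodule.Quotient.mk_smul, Submodule.Quotient.mk_eq_zero] at hb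
  obtain ⟨u, hvu, hub⟩ := hm b hb (μ / 2) (half_pos hμ)
  refine (hle _ hub).not_gt ?_
  rw [v.map_mul', ← add_halves μ, WithTop.coe_add]
  exact WithTop.add_lt_add hvu hvb

theorem isDomain_of_map_algebraMap_ne_top {R : Type*} [CommRing R] [Nontrivial R] [Algebra R T]
    (hv : ∀ c : R, c ≠ 0 → v (algebraMap R T c) ≠ ⊤) : IsDomain R := by
  have : NoZeroDivisors R := ⟨fun {a b} hab => by
    by_contra! h
    have htop : v (algebraMap R T a) + v (algebraMap R T b) = ⊤ := by
      rw [← v.map_mul', ← map_mul, hab, map_zero, v.map_zero']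
    exact (WithTop.add_eq_top.1 htop).elim (hv a h.1) (hv b h.2)⟩
  exact NoZeroDivisors.to_isDomain R

end ValueMap

section Factor

variable {ι R M P : Type*} [LinearOrder ι] [CommRing R] [AddCommGroup M] [Module R M]
  [AddCommGroup P] [Module R P] {f : P →ₗ[R] M} {g : M →ₗ[R] P} {c : R} {x : ι → R} {i : ℕ}

theorem KoszulLimitVanishes.exists_smul_koszulShift_mem (hP : KoszulLimitVanishes x P i)
    (hfg : ∀ m, f (g m) = c • m) {a : ℕ} {m : Finset ι → M}
    (hm : m ∈ koszulCocycles (x ^ a) M i) :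
    ∃ e, c • koszulShift x e m ∈ koszulCoboundaries (x ^ (a + e)) M i := by
  obtain ⟨e, he⟩ := hP a (g ∘ m) (comp_mem_koszulCocycles g (fun j => g.map_smul _) hm)
  refine ⟨e, ?_⟩
  have h := comp_mem_koszulCoboundaries f (fun j => f.map_smul _) he
  rw [comp_koszulShift fun j => f.map_smul _] at h
  rwa [← map_smul, show c • m = f ∘ g ∘ m from funext fun s => (hfg (m s)).symm]

end Factor

section Frobenius

variable (p : ℕ) {R T A : Type*} [CommRing R] [CommRing T] [CommRing A] [Algebra R T]
  [Algebra T A] [Algebra R A] [IsScalarTower R T A] {S' : Subalgebra R A}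

theorem exists_forall_pow_mem (hS' : ∀ y : A, ∃ N, y ^ p ^ N ∈ S') {κ : Type*} [Finite κ]
    (y : κ → A) : ∃ N₀, ∀ N, N₀ ≤ N → ∀ k, y k ^ p ^ N ∈ S' := by
  cases nonempty_fintype κ
  choose N hN using fun k => hS' (y k)
  refine ⟨∑ k, N k, fun M hM k => ?_⟩
  have hk : N k ≤ M := (Finset.single_le_sum_of_canonicallyOrdered (Finset.mem_univ k)).trans hM
  rw [← Nat.add_sub_cancel' hk, pow_add, pow_mul]
  exact S'.pow_mem (hN k) _

variable [Fact p.Prime] [CharP A p] [PerfectRing A p]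

theorem exists_smul_koszulShift_mem_of_pow_mem {ι P : Type*} [LinearOrder ι] [AddCommGroup P]
    [Module R P] {f : P →ₗ[R] S'} {g : S' →ₗ[R] P} {c : R} (hfg : ∀ s, f (g s) = c • s)
    {x : ι → R} {i N : ℕ} (hP : KoszulLimitVanishes (x ^ p ^ N) P i) {b : T}
    (hb : b ^ p ^ N = algebraMap R T c) {a : ℕ} {m : Finset ι → A}
    (hm : m ∈ koszulCocycles ((algebraMap R T ∘ x) ^ a) A i) (hmS : ∀ s, m s ^ p ^ N ∈ S') :
    ∃ e, b • koszulShift (algebraMap R T ∘ x) e m ∈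
      koszulCoboundaries ((algebraMap R T ∘ x) ^ (a + e)) A i := by
  let F : A →+* A := iterateFrobenius A p N
  have hF_smul : ∀ (t : T) (r : R), t ^ p ^ N = algebraMap R T r → ∀ y, F (t • y) = r • F y :=
    fun t r htr y => by
      simp only [F, iterateFrobenius_def, smul_pow, htr, algebraMap_smul]
  have hF : ∀ j y, F ((algebraMap R T ∘ x) j • y) = (x ^ p ^ N) j • F y := fun j =>
    hF_smul _ _ (map_pow _ _ _).symm
  have hFa : ∀ a j y, F (((algebraMap R T ∘ x) ^ a) j • y) = ((x ^ p ^ N) ^ a) j • F y :=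
    fun a j => map_pow_smul_of_map_smul (hF j) a
  let μ : Finset ι → S' := fun s => ⟨F (m s), hmS s⟩
  have hμ : μ ∈ koszulCocycles ((x ^ p ^ N) ^ a) S' i :=
    mem_koszulCocycles_of_comp_mem S'.val (fun _ => map_smul S'.val _) Subtype.val_injective
      (comp_mem_koszulCocycles (U := R) F (hFa a) hm)
  obtain ⟨e, he⟩ := hP.exists_smul_koszulShift_mem hfg hμ
  refine ⟨e, mem_koszulCoboundaries_of_comp_mem (U := R) F (hFa (a + e))
    (bijective_iterateFrobenius A p N) ?_⟩
  have hcomp : F ∘ (b • koszulShift (algebraMap R T ∘ x) e m) =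
      S'.val ∘ (c • koszulShift (x ^ p ^ N) e μ) := funext fun s =>
    calc F (b • koszulShift (algebraMap R T ∘ x) e m s)
      _ = c • F (koszulShift (algebraMap R T ∘ x) e m s) := hF_smul b c hb _
      _ = c • koszulShift (x ^ p ^ N) e (F ∘ m) s :=
        congrArg (c • ·) (congrFun (comp_koszulShift (U := R) hF e m) s)
      _ = c • S'.val (koszulShift (x ^ p ^ N) e μ s) :=
        congrArg (c • ·) (congrFun (comp_koszulShift (fun _ => map_smul S'.val _) e μ) s).symm
      _ = S'.val (c • koszulShift (x ^ p ^ N) e μ s) := (map_smul S'.val c _).symm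
  rw [hcomp]
  exact comp_mem_koszulCoboundaries S'.val (fun _ => map_smul S'.val _) he

variable [CharP T p] [PerfectRing T p] (v : ValueMap T)

theorem almostZero_cechCohomology_of_pow_mem (hS' : ∀ y : A, ∃ N, y ^ p ^ N ∈ S') {P : Type*}
    [AddCommGroup P] [Module R P] {f : P →ₗ[R] S'} {g : S' →ₗ[R] P} {c : R}
    (hfg : ∀ s, f (g s) = c • s) (hc : v (algebraMap R T c) ≠ ⊤) {n i : ℕ} {x : Fin n → R}
    (hP : ∀ N, KoszulLimitVanishes (x ^ p ^ N) P i) :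
    AlmostZero v (CechCohomology (algebraMap R T ∘ x) A i) := by
  refine almostZero_cechCohomology _ v fun a m hm ε hε => ?_
  obtain ⟨N₀, hN₀⟩ := exists_forall_pow_mem p hS' m
  obtain ⟨N, hN, b, hb, hvb⟩ := v.exists_pow_eq_lt p hc hε N₀
  exact ⟨b, hvb, exists_smul_koszulShift_mem_of_pow_mem p hfg (hP N) hb hm (hN₀ N hN)⟩

end Frobenius

theorem mem_span_range_of_pow_mem {T ι : Type*} [CommRing T] {p : ℕ} [Fact p.Prime] [CharP T p]
    [PerfectRing T p] [Finite ι] {y : ι → T} {t : T} {N : ℕ}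
    (ht : t ^ p ^ N ∈ Ideal.span (Set.range (y ^ p ^ N))) : t ∈ Ideal.span (Set.range y) := by
  cases nonempty_fintype ι
  obtain ⟨d, hd⟩ := Ideal.mem_span_range_iff_exists_fun.1 ht
  obtain ⟨e, rfl⟩ := (bijective_iterateFrobenius T p N).surjective.comp_left d
  refine Ideal.mem_span_range_iff_exists_fun.2 ⟨e, (bijective_iterateFrobenius T p N).injective ?_⟩
  simp only [Function.comp_apply, Pi.pow_apply, iterateFrobenius_def, ← mul_pow] at hd ⊢
  rw [sum_pow_char_pow, hd]

section Purity

variable {p : ℕ} [Fact p.Prime] {R T A : Type*} [CommRing R] [CommRing T] [CommRing A]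
  [Algebra R T] [Algebra T A] [Algebra R A] [IsScalarTower R T A] {S' : Subalgebra R A}

theorem isIntegral_of_pow_mem [Module.Finite R S'] (hS' : ∀ y : A, ∃ N, y ^ p ^ N ∈ S') :
    Algebra.IsIntegral R A := ⟨fun y => by
  obtain ⟨N, hN⟩ := hS' y
  have h : IsIntegral R (⟨_, hN⟩ : S') := Algebra.IsIntegral.isIntegral _
  exact .of_pow (pow_pos (Fact.out : p.Prime).pos N) (h.map S'.val)⟩

theorem map_maximalIdeal_ne_top [IsLocalRing R] [Nontrivial T] [Algebra.IsIntegral R T] :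
    (IsLocalRing.maximalIdeal R).map (algebraMap R T) ≠ ⊤ := by
  rw [Ne, Ideal.map_eq_top_iff_of_ker_le _ (IsLocalRing.le_maximalIdeal (RingHom.ker_ne_top _))
    (algebraMap_isIntegral_iff.2 ‹_›)]
  exact Ideal.IsPrime.ne_top'

variable [CharP T p] [PerfectRing T p]

theorem mul_mem_span_range_of_pow_eq {ι M : Type*} [Fintype ι] [AddCommGroup M] [Module R M]
    (h : M →ₗ[R] R) {m : M} {x : ι → R} {μ : ι → M} {β : R} {N : ℕ} {b u : T}
    (hb : b ^ p ^ N = algebraMap R T β) (hu : u ^ p ^ N = algebraMap R T (h m))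
    (hsum : β • m = ∑ j, x j ^ p ^ N • μ j) :
    u * b ∈ Ideal.span (Set.range (algebraMap R T ∘ x)) := by
  have hmul : h m * β = ∑ j, h (μ j) * x j ^ p ^ N := by
    simpa only [map_smul, map_sum, smul_eq_mul, mul_comm] using congrArg h hsum
  refine mem_span_range_of_pow_mem (p := p) (N := N) ?_
  rw [mul_pow, hu, hb, ← map_mul, hmul, map_sum]
  refine Ideal.sum_mem _ fun j _ => ?_
  rw [map_mul, map_pow]
  exact Ideal.mul_mem_left _ _ (Ideal.subset_span ⟨j, rfl⟩)

theorem exists_mul_mem_map_of_smul_one_mem [CharP A p] (hS' : ∀ y : A, ∃ N, y ^ p ^ N ∈ S')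
    (hT : ∀ t : T, ∃ N, t ^ p ^ N ∈ (⊥ : Subalgebra R T)) {h : S' →ₗ[R] R} {v : ValueMap T}
    (hh : v (algebraMap R T (h 1)) ≠ ⊤) {I : Ideal R} (hI : I.FG) {b : T}
    (hb : b • (1 : A) ∈ I.map (algebraMap R T) • (⊤ : Submodule T A)) {ε : ℝ} (hε : 0 < ε) :
    ∃ u : T, v u < (ε : WithTop ℝ) ∧ u * b ∈ I.map (algebraMap R T) := by
  obtain ⟨n, x, hx⟩ := Submodule.fg_iff_exists_fin_generating_family.1 hI
  obtain rfl : Ideal.span (Set.range x) = I := hx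
  rw [Ideal.smul_top_eq_map, Submodule.restrictScalars_mem, ← Algebra.algebraMap_eq_smul_one,
    Ideal.map_map, ← IsScalarTower.algebraMap_eq, Ideal.map_span, ← Set.range_comp] at hb
  obtain ⟨γ, hγ⟩ := Ideal.mem_span_range_iff_exists_fun.1 hb
  obtain ⟨N₁, hN₁⟩ := exists_forall_pow_mem p hS' γ
  obtain ⟨N₂, hN₂⟩ := exists_forall_pow_mem p hT fun _ : Unit => b
  obtain ⟨N, hN, u, hu, hvu⟩ := v.exists_pow_eq_lt p hh hε (max N₁ N₂)
  obtain ⟨β, hβ⟩ := Algebra.mem_bot.1 (hN₂ N ((le_max_right _ _).trans hN) ())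
  have hsum : β • (1 : S') = ∑ j, x j ^ p ^ N • ⟨_, hN₁ N ((le_max_left _ _).trans hN) j⟩ := by
    apply Subtype.val_injective
    calc β • (1 : A) = algebraMap T A b ^ p ^ N := by
          rw [← Algebra.algebraMap_eq_smul_one, IsScalarTower.algebraMap_apply R T A, hβ, map_pow]
      _ = ∑ j, x j ^ p ^ N • γ j ^ p ^ N := by
          rw [← hγ, sum_pow_char_pow]
          exact Finset.sum_congr rfl fun j _ => by
            rw [Function.comp_apply, mul_comm, ← Algebra.smul_def, smul_pow]
      _ = _ := by simp only [AddSubmonoidClass.coe_finsetSum, Subalgebra.coe_smul]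
  rw [Ideal.map_span, ← Set.range_comp]
  exact ⟨u, hvu, mul_mem_span_range_of_pow_eq h hβ.symm hu hsum⟩

end Purity

theorem radical_span_range_pow {R ι : Type*} [CommRing R] (x : ι → R) {k : ℕ} (hk : k ≠ 0) :
    (Ideal.span (Set.range (x ^ k))).radical = (Ideal.span (Set.range x)).radical := by
  refine le_antisymm (Ideal.radical_mono ?_) (Ideal.radical_le_radical_iff.2 ?_)
  · rw [Ideal.span_le]
    rintro _ ⟨j, rfl⟩
    exact Ideal.pow_mem_of_mem _ (Ideal.subset_span (Set.mem_range_self j)) k hk.bot_lt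
  · rw [Ideal.span_le]
    rintro _ ⟨j, rfl⟩
    exact ⟨k, Ideal.subset_span ⟨j, rfl⟩⟩

section AlmostCohenMacaulay

open IsLocalRing

variable (p : ℕ) [Fact p.Prime] {R T A : Type*} [CommRing R] [IsLocalRing R] [IsNoetherianRing R]
  {rs : List R} (hrs : RingTheory.Sequence.IsRegular R rs)
  (hlen : (rs.length : WithBot ℕ∞) = ringKrullDim R) [CommRing T] [CommRing A]
  [Algebra R T] [Algebra T A] [Algebra R A] [IsScalarTower R T A]
  [CharP A p] [PerfectRing A p] [CharP T p] [PerfectRing T p]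
  {S' : Subalgebra R A} [Module.Finite R S'] (hS' : ∀ y : A, ∃ N, y ^ p ^ N ∈ S')
  {v : ValueMap T} (hv : v.IsNormalized) (hv' : ∀ c : R, c ≠ 0 → v (algebraMap R T c) ≠ ⊤)
include hrs hlen hS' hv hv'

theorem isAlmostCohenMacaulay_of_pow_mem [Algebra.IsIntegral R T]
    (hpure : ∀ b : T, b • (1 : A) ∈ (maximalIdeal R).map (algebraMap R T) • (⊤ : Submodule T A) →
      ∀ ε : ℝ, 0 < ε →
        ∃ u : T, v u < (ε : WithTop ℝ) ∧ u * b ∈ (maximalIdeal R).map (algebraMap R T)) :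
    IsAlmostCohenMacaulay R v A := by
  have := ValueMap.isDomain_of_map_algebraMap_ne_top hv'
  have : Nontrivial T := CharP.nontrivial_of_char_ne_one (Fact.out : p.Prime).ne_one
  obtain ⟨B, f, g, c, hc, hfg⟩ := exists_linearMap_finsupp_comp_eq_smul R S'
  have hfg𝔪 : ((maximalIdeal R).map (algebraMap R T)).FG :=
    Ideal.FG.map (IsNoetherian.noetherian _) _
  refine ⟨fun n x hx i hi => ?_,
    ValueMap.not_almostZero_quotient hv hfg𝔪 map_maximalIdeal_ne_top 1 hpure⟩
  refine almostZero_cechCohomology_of_pow_mem p v hS' hfg (hv' c hc) fun N =>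
    koszulLimitVanishes_finsupp_of_isRegular hrs hlen B ?_ hi
  rw [radical_span_range_pow x (pow_ne_zero N (Fact.out : p.Prime).ne_zero), hx]
  exact (maximalIdeal.isMaximal R).isPrime.radical

end AlmostCohenMacaulay

section PerfectClosure

variable (p : ℕ) [Fact p.Prime] (R S : Type*) [CommRing R] [CommRing S] [CharP S p] [Algebra R S]

instance isScalarTower_perfectClosure : IsScalarTower R S (PerfectClosure S p) :=
  .of_algebraMap_eq fun _ => rfl

/-- The image of `S` in its perfect closure, as an `R`-subalgebra. -/
noncomputable def perfectClosureRange : Subalgebra R (PerfectClosure S p) :=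
  (IsScalarTower.toAlgHom R S (PerfectClosure S p)).range

instance [Module.Finite R S] : Module.Finite R (perfectClosureRange p R S) :=
  .of_surjective (IsScalarTower.toAlgHom R S (PerfectClosure S p)).rangeRestrict.toLinearMap
    (AlgHom.rangeRestrict_surjective _)

theorem exists_pow_mem_perfectClosureRange (y : PerfectClosure S p) :
    ∃ N, y ^ p ^ N ∈ perfectClosureRange p R S :=
  let ⟨N, s, hs⟩ := IsPRadical.pow_mem (PerfectClosure.of S p) p y
  ⟨N, s, hs⟩

variable {R S} in
theorem smul_one_perfectClosureRange_ne_zero [IsReduced R]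
    (hinj : Function.Injective (algebraMap R S)) {c : R} (hc : c ≠ 0) :
    c • (1 : perfectClosureRange p R S) ≠ 0 := by
  intro h
  have h0 : PerfectClosure.of S p (algebraMap R S c) = 0 := by
    have := congrArg Subtype.val h
    rwa [Subalgebra.coe_smul, Subalgebra.coe_one, ← Algebra.algebraMap_eq_smul_one] at this
  obtain ⟨N, hN⟩ := mem_pNilradical.1 (IsPRadical.ker_le (PerfectClosure.of S p) p h0)
  rw [← map_pow, ← map_zero (algebraMap R S)] at hN
  exact hc (eq_zero_of_pow_eq_zero (hinj hN))

end PerfectClosure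

end AlmostCM

open AlmostCM in
theorem corollary6p10_general (p : ℕ) [Fact p.Prime] (R S : Type*) [CommRing R] [IsLocalRing R]
    [IsNoetherianRing R] [CharP R p] {rs : List R} (hrs : RingTheory.Sequence.IsRegular R rs)
    (hlen : (rs.length : WithBot ℕ∞) = ringKrullDim R) [CommRing S] [CharP S p] [Algebra R S]
    [Module.Finite R S] (hinj : Function.Injective (algebraMap R S)) :
    (∀ v : ValueMap (PerfectClosure S p), v.IsNormalized →
      (∀ c : R, c ≠ 0 → v (algebraMap R (PerfectClosure S p) c) ≠ ⊤) →
      IsAlmostCohenMacaulay R v (PerfectClosure S p)) ∧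
    (∀ v : ValueMap (PerfectClosure R p), v.IsNormalized →
      (∀ c : R, c ≠ 0 → v (algebraMap R (PerfectClosure R p) c) ≠ ⊤) →
      letI : Module (PerfectClosure R p) (PerfectClosure S p) := perfectClosureModule p R S
      IsAlmostCohenMacaulay R v (PerfectClosure S p)) := by
  have hS := exists_pow_mem_perfectClosureRange p R S
  refine ⟨fun v hv hv' => ?_, fun v hv hv' => ?_⟩
  · have := isIntegral_of_pow_mem hS
    refine isAlmostCohenMacaulay_of_pow_mem p hrs hlen hS hv hv' fun b hb ε hε => ?_
    obtain ⟨-, -, u, -, hu⟩ := v.exists_pow_eq_lt p (by simpa using hv' 1 one_ne_zero) hε 0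
    refine ⟨u, hu, Ideal.mul_mem_left _ u ?_⟩
    simpa using hb
  · let : Algebra (PerfectClosure R p) (PerfectClosure S p) := (perfectClosureMap p R S).toAlgebra
    have : IsScalarTower R (PerfectClosure R p) (PerfectClosure S p) :=
      .of_algebraMap_eq fun _ => rfl
    have := ValueMap.isDomain_of_map_algebraMap_ne_top hv'
    have hR : ∀ t : PerfectClosure R p, ∃ N, t ^ p ^ N ∈ (⊥ : Subalgebra R (PerfectClosure R p)) :=
      exists_pow_mem_perfectClosureRange p R R
    have := isIntegral_of_pow_mem hR
    obtain ⟨h, hh⟩ := exists_linearMap_apply_ne_zero fun c hc =>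
      smul_one_perfectClosureRange_ne_zero p hinj (c := c) hc
    exact isAlmostCohenMacaulay_of_pow_mem p hrs hlen hS hv hv' fun b hb ε hε =>
      exists_mul_mem_map_of_smul_one_mem hS hR (hv' _ hh) (IsNoetherian.noetherian _) hb hε

theorem corollary6p10 (p : ℕ) [Fact p.Prime] (R S : Type*)
    [CommRing R] [IsRegularLocalRing R] [CharP R p]
    [CommRing S] [IsLocalRing S] [IsReduced S] [CharP S p]
    [Algebra R S] [Module.Finite R S]
    (hinj : Function.Injective (algebraMap R S)) :
    (∀ v : AlmostCM.ValueMap (PerfectClosure S p), v.IsNormalized →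
      (∀ c : R, c ≠ 0 → v (algebraMap R (PerfectClosure S p) c) ≠ ⊤) →
      AlmostCM.IsAlmostCohenMacaulay R v (PerfectClosure S p)) ∧
    (∀ v : AlmostCM.ValueMap (PerfectClosure R p), v.IsNormalized →
      (∀ c : R, c ≠ 0 → v (algebraMap R (PerfectClosure R p) c) ≠ ⊤) →
      letI : Module (PerfectClosure R p) (PerfectClosure S p) :=
        AlmostCM.perfectClosureModule p R S
      AlmostCM.IsAlmostCohenMacaulay R v (PerfectClosure S p)) := by
  obtain ⟨rs, hrs, hlen⟩ := AlmostCM.exists_isRegular_length_eq_ringKrullDim R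
  exact corollary6p10_general p R S hrs hlen hinj
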